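/- Let $\mathcal H$ be a complex Hilbert space and let $A, B$ be bounded positive operators on $\mathcal H$ with $0\le A\le B$, where $S\le T$ means that $T-S$ is positive. The following assertions are equivalent: (i) $A=[A]B$, where $[A]B:=\sup_{n\in\mathbb N} B:(nA)$ is the generalized short of $B$ with respect to $A$ (supremum in the operator order), and the parallel sum $S:T$ of two bounded positive operators $S,T$ is the unique bounded operator with $$\langle (S:T)x,x\rangle=\inf_{y\in\mathcal H}\big\{\langle S(x-y),x-y\rangle+\langle Ty,y\rangle\big\},\qquad x\in\mathcal H;$$ (ii) there is an orthogonal projection $P$ on $\mathcal H_B$ such that $A=J_BPJ_B^*$, where $\mathcal H_B$ is the Hilbert space completion of $\operatorname{ran} B$ with respect to the inner product $\langle Bx,By\rangle_B=\langle Bx,y\rangle$, and $J_B\colon\mathcal H_B\to\mathcal H$ is the continuous extension of the map $\operatorname{ran}B\ni Bx\mapsto Bx\in\mathcal H$; (iii) $A$ is an extreme point of the operator interval $[0,B]=\{C : C \text{ bounded positive},\ C\le B\}$; (iv) $A$ and $B-A$ are singular, i.e. $\operatorname{ran}A^{1/2}\cap\operatorname{ran}(B-A)^{1/2}=\{0\}$.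 -/

import Mathlib

open scoped InnerProductSpace

noncomputable section

namespace QuasiUnit

set_option linter.unusedSectionVars false

variable {H : Type*} [NormedAddCommGroup H] [InnerProductSpace ℂ H] [CompleteSpace H]

/-! ### Elementary facts on positive operators -/

theorem inner_nonneg {A : H →L[ℂ] H} (hA : 0 ≤ A) (x : H) : 0 ≤ (⟪A x, x⟫_ℂ).re :=
  ((ContinuousLinearMap.nonneg_iff_isPositive A).1 hA).re_inner_nonneg_left x

theorem inner_symm {A : H →L[ℂ] H} (hA : 0 ≤ A) (x y : H) : ⟪A x, y⟫_ℂ = ⟪x, A y⟫_ℂ :=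
  ((ContinuousLinearMap.nonneg_iff_isPositive A).1 hA).isSymmetric x y

theorem inner_im {A : H →L[ℂ] H} (hA : 0 ≤ A) (x : H) : (⟪A x, x⟫_ℂ).im = 0 := by
  have h := inner_conj_symm (𝕜 := ℂ) (A x) x
  rw [← inner_symm hA] at h
  exact Complex.conj_eq_iff_im.1 h

theorem inner_mono {A B : H →L[ℂ] H} (h : A ≤ B) (x : H) :
    (⟪A x, x⟫_ℂ).re ≤ (⟪B x, x⟫_ℂ).re := by
  have := inner_nonneg (sub_nonneg.2 h) x
  simpa [inner_sub_left] using this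

theorem le_of_inner_le {A B : H →L[ℂ] H} (hA : 0 ≤ A) (hB : 0 ≤ B)
    (h : ∀ x, (⟪A x, x⟫_ℂ).re ≤ (⟪B x, x⟫_ℂ).re) : A ≤ B := by
  rw [ContinuousLinearMap.le_def]
  refine ⟨fun x y => ?_, fun x => ?_⟩
  · simp [inner_sub_left, inner_sub_right, inner_symm hA, inner_symm hB]
  · simpa [ContinuousLinearMap.reApplyInnerSelf, inner_sub_left] using h x

/-- `‖A x‖² ≤ ‖A‖ ⟨A x, x⟩` for a positive operator `A`. -/
theorem norm_apply_sq_le {A : H →L[ℂ] H} (hA : 0 ≤ A) (x : H) :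
    ‖A x‖ ^ 2 ≤ ‖A‖ * (⟪A x, x⟫_ℂ).re := by
  set s := CFC.sqrt A with hs
  have hs0 : 0 ≤ s := CFC.sqrt_nonneg A
  have hss : s * s = A := CFC.sqrt_mul_sqrt_self A hA
  have h1 : A x = s (s x) := by rw [← hss]; rfl
  have h2 : (⟪A x, x⟫_ℂ).re = ‖s x‖ ^ 2 := by
    rw [h1, inner_symm hs0]
    exact (norm_sq_eq_re_inner (𝕜 := ℂ) _).symm
  have h3 : ‖A‖ = ‖s‖ * ‖s‖ := by
    rw [← hss]
    nth_rewrite 1 [← (IsSelfAdjoint.of_nonneg hs0).star_eq]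
    exact CStarRing.norm_star_mul_self
  rw [h2, h3, h1]
  have := s.le_opNorm (s x)
  calc ‖s (s x)‖ ^ 2 ≤ (‖s‖ * ‖s x‖) ^ 2 := by gcongr
    _ = _ := by ring

/-! ### The auxiliary Hilbert space of a positive operator -/

/-- The range of the positive operator `B`, as a vector space that is going to carry the inner
product `⟨B x, B y⟩_B = ⟨B x, y⟩` (and not the one inherited from `H`). -/
def RanSpace (B : H →L[ℂ] H) (_hB : 0 ≤ B) : Type _ := LinearMap.range (B : H →ₗ[ℂ] H)

namespace RanSpace

variable (B : H →L[ℂ] H) (hB : 0 ≤ B)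

instance : AddCommGroup (RanSpace B hB) :=
  inferInstanceAs (AddCommGroup (LinearMap.range (B : H →ₗ[ℂ] H)))

instance : Module ℂ (RanSpace B hB) :=
  inferInstanceAs (Module ℂ (LinearMap.range (B : H →ₗ[ℂ] H)))

/-- The inclusion `ran B → H`. -/
def incl : RanSpace B hB →ₗ[ℂ] H := (LinearMap.range (B : H →ₗ[ℂ] H)).subtype

/-- The map `x ↦ B x` from `H` onto `ran B`. -/
def mk : H →ₗ[ℂ] RanSpace B hB := (B : H →ₗ[ℂ] H).rangeRestrict

@[simp] theorem incl_mk (x : H) : incl B hB (mk B hB x) = B x := rfl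

theorem mk_surjective : Function.Surjective (mk B hB) := fun u => by
  obtain ⟨_, x, rfl⟩ := u
  exact ⟨x, rfl⟩

/-- A chosen preimage of an element of `ran B`; the inner product does not depend on it. -/
def lift (u : RanSpace B hB) : H := (mk_surjective B hB u).choose

theorem mk_lift (u : RanSpace B hB) : mk B hB (lift B hB u) = u :=
  (mk_surjective B hB u).choose_spec

theorem apply_lift (u : RanSpace B hB) : B (lift B hB u) = incl B hB u :=
  congrArg (incl B hB) (mk_lift B hB u)

theorem inner_lift (u : RanSpace B hB) (y : H) :
    ⟪incl B hB u, lift B hB (mk B hB y)⟫_ℂ = ⟪incl B hB u, y⟫_ℂ := by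
  rw [← apply_lift, inner_symm hB, inner_symm hB, apply_lift, incl_mk]

theorem inner_lift_symm (u v : RanSpace B hB) :
    ⟪incl B hB u, lift B hB v⟫_ℂ = ⟪lift B hB u, incl B hB v⟫_ℂ := by
  rw [← apply_lift B hB u, inner_symm hB, apply_lift]

/-- The inner product `⟨u, B y⟩_B = ⟨u, y⟩` on `ran B`. -/
@[reducible] def core : InnerProductSpace.Core ℂ (RanSpace B hB) where
  inner u v := ⟪incl B hB u, lift B hB v⟫_ℂ
  conj_inner_symm u v := by
    rw [inner_conj_symm, inner_lift_symm]
  re_inner_nonneg u := by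
    rw [← apply_lift]
    exact inner_nonneg hB _
  add_left u v w := by rw [map_add, inner_add_left]
  smul_left u v r := by rw [map_smul, inner_smul_left]
  definite u hu := by
    have h := norm_apply_sq_le hB (lift B hB u)
    rw [apply_lift, hu] at h
    have h0 : incl B hB u = 0 := by simpa using h
    exact Subtype.ext h0

instance : NormedAddCommGroup (RanSpace B hB) := (core B hB).toNormedAddCommGroup

instance : InnerProductSpace ℂ (RanSpace B hB) :=
  InnerProductSpace.ofCore (core B hB).toCore

/-- The defining identity `⟨B x, B y⟩_B = ⟨B x, y⟩`. -/
theorem inner_mk_mk (x y : H) : ⟪mk B hB x, mk B hB y⟫_ℂ = ⟪B x, y⟫_ℂ :=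
  inner_lift B hB (mk B hB x) y

theorem norm_mk_sq (x : H) : ‖mk B hB x‖ ^ 2 = (⟪B x, x⟫_ℂ).re := by
  rw [← inner_mk_mk B hB]
  exact norm_sq_eq_re_inner (𝕜 := ℂ) _

theorem norm_incl_le (u : RanSpace B hB) : ‖incl B hB u‖ ≤ Real.sqrt ‖B‖ * ‖u‖ := by
  obtain ⟨x, rfl⟩ := mk_surjective B hB u
  refine le_of_sq_le_sq ?_ (by positivity)
  rw [mul_pow, Real.sq_sqrt (norm_nonneg _), norm_mk_sq, incl_mk]
  exact norm_apply_sq_le hB x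

/-- The inclusion `ran B → H` as a bounded operator from `(ran B, ⟨·, ·⟩_B)` to `H`. -/
def inclL : RanSpace B hB →L[ℂ] H :=
  (incl B hB).mkContinuous (Real.sqrt ‖B‖) (norm_incl_le B hB)

end RanSpace

/-- The auxiliary Hilbert space `H_B` of a positive operator `B`: the completion of `ran B` with
respect to the inner product `⟨B x, B y⟩_B = ⟨B x, y⟩`. -/
abbrev AuxSpace (B : H →L[ℂ] H) (hB : 0 ≤ B) : Type _ :=
  UniformSpace.Completion (RanSpace B hB)

/-- The canonical embedding operator `J_B : H_B → H`: the continuous extension of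
`ran B ∋ B x ↦ B x ∈ H`. -/
def J (B : H →L[ℂ] H) (hB : 0 ≤ B) : AuxSpace B hB →L[ℂ] H :=
  (RanSpace.inclL B hB).fromCompletion

theorem J_coe_mk (B : H →L[ℂ] H) (hB : 0 ≤ B) (x : H) :
    J B hB (RanSpace.mk B hB x : AuxSpace B hB) = B x := by
  rw [J, ContinuousLinearMap.fromCompletion_apply_coe]
  rfl

/-- The map `x ↦ B x` from `H` into `H_B` (it is the adjoint of `J_B`). -/
def toAux (B : H →L[ℂ] H) (hB : 0 ≤ B) : H →ₗ[ℂ] AuxSpace B hB :=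
  (UniformSpace.Completion.toComplL (𝕜 := ℂ) (E := RanSpace B hB)).toLinearMap ∘ₗ
    RanSpace.mk B hB

theorem denseRange_toAux (B : H →L[ℂ] H) (hB : 0 ≤ B) : DenseRange (toAux B hB) :=
  UniformSpace.Completion.denseRange_coe.comp (RanSpace.mk_surjective B hB).denseRange
    (UniformSpace.Completion.continuous_coe _)

theorem norm_toAux_sq (B : H →L[ℂ] H) (hB : 0 ≤ B) (x : H) :
    ‖toAux B hB x‖ ^ 2 = (⟪B x, x⟫_ℂ).re := by
  rw [← RanSpace.norm_mk_sq B hB]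
  exact congrArg (· ^ 2) (UniformSpace.Completion.norm_coe (RanSpace.mk B hB x))

/-- `J_B^* x = B x`, seen as an element of `H_B`. -/
theorem adjoint_J (B : H →L[ℂ] H) (hB : 0 ≤ B) (x : H) :
    ContinuousLinearMap.adjoint (J B hB) x = toAux B hB x := by
  refine (denseRange_toAux B hB).eq_of_inner_left (𝕜 := ℂ) ?_
  intro y
  have h1 : J B hB (toAux B hB y) = B y := J_coe_mk B hB y
  have h2 : ⟪toAux B hB x, toAux B hB y⟫_ℂ = ⟪B x, y⟫_ℂ :=
    (UniformSpace.Completion.inner_coe _ _).trans (RanSpace.inner_mk_mk B hB x y)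
  rw [ContinuousLinearMap.adjoint_inner_left, h1, h2, inner_symm hB]

/-! ### Parallel sum -/

/-- `C` is an operator with quadratic form
`⟨C x, x⟩ = inf_y (⟨A (x - y), x - y⟩ + ⟨B y, y⟩)`. -/
def HasParallelForm (A B C : H →L[ℂ] H) : Prop :=
  ∀ x : H, ⟪C x, x⟫_ℂ =
    ((⨅ y : H, ((⟪A (x - y), x - y⟫_ℂ).re + (⟪B y, y⟫_ℂ).re) : ℝ) : ℂ)

theorem bddBelow_parallel {A B : H →L[ℂ] H} (hA : 0 ≤ A) (hB : 0 ≤ B) (x : H) :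
    BddBelow (Set.range fun y : H => (⟪A (x - y), x - y⟫_ℂ).re + (⟪B y, y⟫_ℂ).re) :=
  ⟨0, by rintro _ ⟨y, rfl⟩; exact add_nonneg (inner_nonneg hA _) (inner_nonneg hB _)⟩

theorem existsUnique_parallelSum {A B : H →L[ℂ] H} (hA : 0 ≤ A) (hB : 0 ≤ B) :
    ∃! C : H →L[ℂ] H, HasParallelForm A B C := by
  have hS : 0 ≤ A + B := add_nonneg hA hB
  set j := toAux (A + B) hS with hj
  have hdense : DenseRange j := denseRange_toAux _ _
  have hbound : ∀ x, ‖(A : H →ₗ[ℂ] H) x‖ ≤ Real.sqrt ‖A‖ * ‖j x‖ := by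
    intro x
    refine le_of_sq_le_sq ?_ (by positivity)
    rw [mul_pow, Real.sq_sqrt (norm_nonneg _), norm_toAux_sq]
    refine (norm_apply_sq_le hA x).trans ?_
    refine mul_le_mul_of_nonneg_left ?_ (norm_nonneg _)
    have := inner_nonneg hB x
    rw [add_apply, inner_add_left, Complex.add_re]
    linarith
  set R := (A : H →ₗ[ℂ] H).extendOfNorm j with hR
  have hRj : ∀ y, R (j y) = A y := fun y =>
    LinearMap.extendOfNorm_eq hdense ⟨_, hbound⟩ y
  have hCpos : ∀ x, ⟪(A - R ∘L R.adjoint) x, x⟫_ℂ = ((⟪A x, x⟫_ℂ).re - ‖R.adjoint x‖ ^ 2 : ℝ) := by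
    intro x
    have h1 : ⟪A x, x⟫_ℂ = ((⟪A x, x⟫_ℂ).re : ℂ) :=
      Complex.ext (by simp) (by simp [inner_im hA])
    simp only [sub_apply, ContinuousLinearMap.comp_apply, inner_sub_left]
    rw [← ContinuousLinearMap.adjoint_inner_right R, inner_self_eq_norm_sq_to_K, h1]
    simp
  have hform : ∀ x y, (⟪A (x - y), x - y⟫_ℂ).re + (⟪B y, y⟫_ℂ).re
      = ((⟪A x, x⟫_ℂ).re - ‖R.adjoint x‖ ^ 2) + ‖R.adjoint x - j y‖ ^ 2 := by
    intro x y
    have h1 : (⟪R.adjoint x, j y⟫_ℂ).re = (⟪A x, y⟫_ℂ).re := by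
      rw [ContinuousLinearMap.adjoint_inner_left, hRj, inner_symm hA]
    have h2 : (⟪A y, x⟫_ℂ).re = (⟪A x, y⟫_ℂ).re := by
      rw [inner_symm hA, ← inner_conj_symm, Complex.conj_re]
    have h3 := norm_sub_sq (𝕜 := ℂ) (R.adjoint x) (j y)
    rw [h3, norm_toAux_sq]
    simp only [RCLike.re_eq_complex_re, h1]
    simp only [map_sub, inner_sub_left, inner_sub_right, Complex.sub_re, h2,
      add_apply, inner_add_left, Complex.add_re]
    ring
  have hinf : ∀ x, (⨅ y : H, ((⟪A (x - y), x - y⟫_ℂ).re + (⟪B y, y⟫_ℂ).re))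
      = (⟪A x, x⟫_ℂ).re - ‖R.adjoint x‖ ^ 2 := by
    intro x
    refine IsGLB.ciInf_eq ⟨?_, fun b hb => ?_⟩
    · rintro _ ⟨y, rfl⟩
      dsimp only
      rw [hform]
      nlinarith [sq_nonneg ‖R.adjoint x - j y‖]
    · refine le_of_forall_pos_le_add fun ε hε => ?_
      obtain ⟨y, hy⟩ := hdense.exists_dist_lt (R.adjoint x) (Real.sqrt_pos.2 hε)
      have hb' := hb ⟨y, rfl⟩
      dsimp only at hb'
      rw [hform] at hb'
      rw [dist_eq_norm] at hy
      have := Real.lt_sqrt (norm_nonneg _) |>.1 hy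
      linarith
  refine ⟨A - R ∘L R.adjoint, fun x => ?_, fun C hC => ?_⟩
  · rw [hCpos x, hinf x]
  · have hx : ∀ x, ⟪C x, x⟫_ℂ = ⟪(A - R ∘L R.adjoint) x, x⟫_ℂ := fun x => by
      rw [hC x, hCpos x, hinf x]
    exact ContinuousLinearMap.coe_injective
      ((ext_inner_map (C : H →ₗ[ℂ] H) ((A - R ∘L R.adjoint : H →L[ℂ] H) : H →ₗ[ℂ] H)).1 hx)

/-- The parallel sum `A : B` of two positive operators: the unique operator whose quadratic form
is `x ↦ inf_y (⟨A (x - y), x - y⟩ + ⟨B y, y⟩)`. -/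
def parallelSum (A B : H →L[ℂ] H) (hA : 0 ≤ A) (hB : 0 ≤ B) : H →L[ℂ] H :=
  (existsUnique_parallelSum hA hB).choose

theorem parallelSum_form {A B : H →L[ℂ] H} (hA : 0 ≤ A) (hB : 0 ≤ B) :
    HasParallelForm A B (parallelSum A B hA hB) :=
  (existsUnique_parallelSum hA hB).choose_spec.1

theorem parallelSum_re {A B : H →L[ℂ] H} (hA : 0 ≤ A) (hB : 0 ≤ B) (x : H) :
    (⟪parallelSum A B hA hB x, x⟫_ℂ).re =
      ⨅ y : H, ((⟪A (x - y), x - y⟫_ℂ).re + (⟪B y, y⟫_ℂ).re) := by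
  rw [parallelSum_form hA hB x, Complex.ofReal_re]

theorem parallelSum_nonneg {A B : H →L[ℂ] H} (hA : 0 ≤ A) (hB : 0 ≤ B) :
    0 ≤ parallelSum A B hA hB := by
  rw [ContinuousLinearMap.nonneg_iff_isPositive, ContinuousLinearMap.isPositive_iff_complex]
  intro x
  have h := parallelSum_re hA hB x
  refine ⟨?_, ?_⟩
  · rw [parallelSum_form hA hB x]; simp
  · rw [RCLike.re_eq_complex_re, h]
    exact Real.iInf_nonneg fun y => add_nonneg (inner_nonneg hA _) (inner_nonneg hB _)

theorem parallelSum_le_left {A B : H →L[ℂ] H} (hA : 0 ≤ A) (hB : 0 ≤ B) :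
    parallelSum A B hA hB ≤ A := by
  refine le_of_inner_le (parallelSum_nonneg hA hB) hA fun x => ?_
  rw [parallelSum_re]
  refine (ciInf_le (bddBelow_parallel hA hB x) 0).trans (le_of_eq ?_)
  simp

theorem parallelSum_mono_right {A B C : H →L[ℂ] H} (hA : 0 ≤ A) (hB : 0 ≤ B) (hC : 0 ≤ C)
    (h : B ≤ C) : parallelSum A B hA hB ≤ parallelSum A C hA hC := by
  refine le_of_inner_le (parallelSum_nonneg _ _) (parallelSum_nonneg _ _) fun x => ?_
  rw [parallelSum_re, parallelSum_re]
  exact ciInf_mono (bddBelow_parallel hA hB x) fun y => add_le_add_right (inner_mono h y) _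

/-! ### Generalized short -/

/-- A bounded increasing sequence of positive operators has a supremum. -/
theorem exists_isLUB_of_monotone {T : ℕ → H →L[ℂ] H} {B : H →L[ℂ] H} (hT : Monotone T)
    (h0 : 0 ≤ T 0) (hB : ∀ n, T n ≤ B) : ∃ C, IsLUB (Set.range T) C := by
  have hpos : ∀ n, 0 ≤ T n := fun n => h0.trans (hT (Nat.zero_le n))
  have hB0 : 0 ≤ B := (hpos 0).trans (hB 0)
  have hq : ∀ x, CauchySeq fun n => (⟪T n x, x⟫_ℂ).re := fun x =>
    (tendsto_atTop_ciSup (fun m n h => inner_mono (hT h) x)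
      ⟨(⟪B x, x⟫_ℂ).re, by rintro _ ⟨n, rfl⟩; exact inner_mono (hB n) x⟩).cauchySeq
  have hdiff : ∀ x m n, m ≤ n →
      ‖T n x - T m x‖ ^ 2 ≤ ‖B‖ * ((⟪T n x, x⟫_ℂ).re - (⟪T m x, x⟫_ℂ).re) := by
    intro x m n hmn
    have hd : 0 ≤ T n - T m := sub_nonneg.2 (hT hmn)
    have h1 := norm_apply_sq_le hd x
    have h2 : ‖T n - T m‖ ≤ ‖B‖ :=
      CStarAlgebra.norm_le_norm_of_nonneg_of_le hd ((sub_le_self _ (hpos m)).trans (hB n))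
    have h3 := inner_nonneg hd x
    simp only [sub_apply, inner_sub_left, Complex.sub_re] at h1 h3
    exact h1.trans (by gcongr)
  have hc : ∀ x, CauchySeq fun n => T n x := by
    intro x
    rw [Metric.cauchySeq_iff']
    intro ε hε
    have hδ : 0 < ε ^ 2 / (‖B‖ + 1) := by positivity
    obtain ⟨N, hN⟩ := Metric.cauchySeq_iff'.1 (hq x) _ hδ
    refine ⟨N, fun n hn => ?_⟩
    have h1 := hdiff x N n hn
    have h2 := hN n hn
    rw [Real.dist_eq] at h2
    have h3 := (le_abs_self _).trans_lt h2
    rw [dist_eq_norm]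
    refine lt_of_pow_lt_pow_left₀ 2 hε.le (h1.trans_lt ?_)
    rw [lt_div_iff₀ (by positivity)] at h3
    have h4 : 0 ≤ (⟪T n x, x⟫_ℂ).re - (⟪T N x, x⟫_ℂ).re :=
      sub_nonneg.2 (inner_mono (hT hn) x)
    nlinarith
  choose f hf using fun x => cauchySeq_tendsto_of_complete (hc x)
  let C : H →L[ℂ] H := continuousLinearMapOfTendsto T (tendsto_pi_nhds.2 hf)
  have hC : ∀ x, Filter.Tendsto (fun n => (⟪T n x, x⟫_ℂ).re) Filter.atTop
      (nhds (⟪C x, x⟫_ℂ).re) := fun x =>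
    (Complex.continuous_re.tendsto _).comp ((hf x).inner tendsto_const_nhds)
  have hsymm : ∀ x y, ⟪C x, y⟫_ℂ = ⟪x, C y⟫_ℂ := fun x y =>
    tendsto_nhds_unique (((hf x).inner tendsto_const_nhds).congr fun n => inner_symm (hpos n) x y)
      (tendsto_const_nhds.inner (hf y))
  have hC0 : 0 ≤ C := by
    rw [ContinuousLinearMap.nonneg_iff_isPositive]
    exact ⟨hsymm, fun x => ge_of_tendsto' (hC x) fun n => inner_nonneg (hpos n) x⟩
  refine ⟨C, ?_, fun D hD => ?_⟩
  · rintro _ ⟨n, rfl⟩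
    refine le_of_inner_le (hpos n) hC0 fun x => ge_of_tendsto (hC x) ?_
    filter_upwards [Filter.eventually_ge_atTop n] with m hm using inner_mono (hT hm) x
  · have hD0 : 0 ≤ D := (hpos 0).trans (hD ⟨0, rfl⟩)
    exact le_of_inner_le hC0 hD0 fun x =>
      le_of_tendsto' (hC x) fun n => inner_mono (hD ⟨n, rfl⟩) x

theorem exists_generalizedShort {A B : H →L[ℂ] H} (hA : 0 ≤ A) (hB : 0 ≤ B) :
    ∃ C, IsLUB (Set.range fun n : ℕ => parallelSum B (n • A) hB (nsmul_nonneg hA n)) C :=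
  exists_isLUB_of_monotone
    (fun _ _ h => parallelSum_mono_right hB _ _ (nsmul_le_nsmul_left hA h))
    (parallelSum_nonneg _ _) (fun _ => parallelSum_le_left _ _)

/-- The generalized short `[A]B = sup_n B : (n A)` of the positive operator `B` with respect to
the positive operator `A`; the supremum is taken in the usual order of operators. -/
def generalizedShort (A B : H →L[ℂ] H) (hA : 0 ≤ A) (hB : 0 ≤ B) : H →L[ℂ] H :=
  (exists_generalizedShort hA hB).choose

theorem generalizedShort_isLUB {A B : H →L[ℂ] H} (hA : 0 ≤ A) (hB : 0 ≤ B) :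
    IsLUB (Set.range fun n : ℕ => parallelSum B (n • A) hB (nsmul_nonneg hA n))
      (generalizedShort A B hA hB) :=
  (exists_generalizedShort hA hB).choose_spec

/-! ### Singularity -/

/-- Singularity `A ⊥ B` of positive operators: `ran A^{1/2} ∩ ran B^{1/2} = {0}`. -/
def Singular (A B : H →L[ℂ] H) : Prop :=
  Set.range (CFC.sqrt A : H →L[ℂ] H) ∩ Set.range (CFC.sqrt B : H →L[ℂ] H) = {0}

end QuasiUnit

end

/-!
Put `j = J_B`. Its adjoint is `x ↦ B x ∈ H_B`, which has dense range, and `j j† = B`. Hence the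
compression `T ↦ j T j†` is an injective affine map, and it carries the positive contractions of
`H_B` onto the interval `[0, B]`: if `0 ≤ C ≤ B` then `‖C^{1/2} x‖ ≤ ‖j† x‖`, so `C^{1/2} = R j†`
for a contraction `R`, and `C = j (R† R) j†` (`exists_compress_eq`). In particular `A = j T j†` for
a unique positive contraction `T`, and each of the four assertions says that `T` is a projection.

* For the factorization of `A` this is the injectivity of the compression (`compress_injective`).
* Extreme points of `[0, B]` correspond to extreme points of the set of positive contractions,
  and these are the projections (`compress_mem_extremePoints_iff`).
* The square roots of `A` and `B - A` are `j R†` and `j S†` with `R† R = T` and `S† S = 1 - T`. Both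
  ranges contain the range of `j T (1 - T)`, and if `T` is a projection then `R S† = 0`
  (`singular_compress_iff`).
* The form of `B : (n A)` at `x` is the infimum over `w` of `‖k - w‖² + n ⟨T w, w⟩`, where
  `k = j† x`. If these forms stay below `⟨T k, k⟩`, then letting `n → ∞` gives
  `⟨T k, k⟩ ≤ ‖T k‖²`, so `T = T²`. If `T` is a projection, they lie between
  `n / (n + 1) ⟨T k, k⟩` and `⟨T k, k⟩` (`eq_generalizedShort_compress_iff`).
-/

namespace QuasiUnit

open ContinuousLinearMap

/-! ### Compressing operators along an operator whose adjoint has dense range -/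

section Compression

variable {H K : Type*} [NormedAddCommGroup H] [InnerProductSpace ℂ H] [CompleteSpace H]
  [NormedAddCommGroup K] [InnerProductSpace ℂ K] [CompleteSpace K]

/-- The real-linear map `T ↦ j T j†` from operators on `K` to operators on `H`, for `j : K → H`. -/
noncomputable def compress (j : K →L[ℂ] H) : (K →L[ℂ] K) →ₗ[ℝ] (H →L[ℂ] H) where
  toFun T := j ∘L T ∘L adjoint j
  map_add' S T := by ext x; simp
  map_smul' r T := by ext x; simp

theorem compress_apply (j : K →L[ℂ] H) (T : K →L[ℂ] K) (x : H) :
    compress j T x = j (T (adjoint j x)) := rfl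

theorem inner_compress (j : K →L[ℂ] H) (T : K →L[ℂ] K) (x y : H) :
    ⟪compress j T x, y⟫_ℂ = ⟪T (adjoint j x), adjoint j y⟫_ℂ := by
  rw [compress_apply, adjoint_inner_right]

theorem compress_nonneg (j : K →L[ℂ] H) {T : K →L[ℂ] K} (hT : 0 ≤ T) : 0 ≤ compress j T := by
  rw [nonneg_iff_isPositive] at hT ⊢
  exact hT.conj_adjoint j

theorem compress_mono (j : K →L[ℂ] H) {S T : K →L[ℂ] K} (h : S ≤ T) :
    compress j S ≤ compress j T := by
  have := compress_nonneg j (sub_nonneg.2 h)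
  rwa [map_sub, sub_nonneg] at this

/-- An operator whose adjoint has dense range is injective. -/
theorem injective_of_denseRange_adjoint {j : K →L[ℂ] H} (hj : DenseRange (adjoint j)) :
    Function.Injective j := by
  intro a b hab
  refine hj.eq_of_inner_left (𝕜 := ℂ) fun y => ?_
  rw [adjoint_inner_right, adjoint_inner_right, hab]

theorem compress_injective {j : K →L[ℂ] H} (hj : DenseRange (adjoint j)) :
    Function.Injective (compress j) := by
  intro S T h
  refine ContinuousLinearMap.ext fun k => ?_
  refine congrFun (hj.equalizer S.continuous T.continuous (funext fun x => ?_)) k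
  exact injective_of_denseRange_adjoint hj (congrArg (· x) h : compress j S x = compress j T x)

/-- If `0 ≤ C ≤ j j†`, then `‖C^{1/2} x‖ ≤ ‖j† x‖`, so that `C^{1/2}` factors through `j†`
by a contraction. -/
theorem exists_sqrt_eq_comp_adjoint {j : K →L[ℂ] H} (hj : DenseRange (adjoint j))
    {C : H →L[ℂ] H} (hC : 0 ≤ C) (hCj : C ≤ compress j 1) :
    ∃ R : K →L[ℂ] H, ‖R‖ ≤ 1 ∧ CFC.sqrt C = R ∘L adjoint j := by
  have hs := CFC.sqrt_nonneg C
  have hbound : ∀ x, ‖(CFC.sqrt C : H →L[ℂ] H).toLinearMap x‖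
      ≤ 1 * ‖(adjoint j).toLinearMap x‖ := by
    intro x
    rw [one_mul]
    refine le_of_sq_le_sq ?_ (norm_nonneg _)
    have h1 := inner_mono hCj x
    rw [inner_compress] at h1
    have h2 : C x = CFC.sqrt C (CFC.sqrt C x) := by
      conv_lhs => rw [← CFC.sqrt_mul_sqrt_self C hC]
      rfl
    rw [h2, inner_symm hs] at h1
    simpa [inner_self_eq_norm_sq_to_K, ← Complex.ofReal_pow] using h1
  refine ⟨(CFC.sqrt C : H →L[ℂ] H).toLinearMap.extendOfNorm (adjoint j).toLinearMap,
    LinearMap.opNorm_extendOfNorm_le hj zero_le_one hbound, ?_⟩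
  ext x
  exact (LinearMap.extendOfNorm_eq hj ⟨1, hbound⟩ x).symm

theorem sqrt_eq_comp_adjoint_right {j : K →L[ℂ] H} {C : H →L[ℂ] H} {R : K →L[ℂ] H}
    (h : CFC.sqrt C = R ∘L adjoint j) : CFC.sqrt C = j ∘L adjoint R := by
  have := (IsSelfAdjoint.of_nonneg (CFC.sqrt_nonneg C)).star_eq
  rw [star_eq_adjoint, h, adjoint_comp, adjoint_adjoint] at this
  rw [h, this]

theorem compress_adjoint_comp_self {j : K →L[ℂ] H} {C : H →L[ℂ] H} (hC : 0 ≤ C)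
    {R : K →L[ℂ] H} (h : CFC.sqrt C = R ∘L adjoint j) : compress j (adjoint R ∘L R) = C := by
  conv_rhs => rw [← CFC.sqrt_mul_sqrt_self C hC]
  nth_rewrite 1 [sqrt_eq_comp_adjoint_right h]
  rw [h]
  rfl

/-- Every operator of the interval `[0, j j†]` is the compression of a positive contraction. -/
theorem exists_compress_eq {j : K →L[ℂ] H} (hj : DenseRange (adjoint j))
    {C : H →L[ℂ] H} (hC : 0 ≤ C) (hCj : C ≤ compress j 1) :
    ∃ T : K →L[ℂ] K, 0 ≤ T ∧ ‖T‖ ≤ 1 ∧ compress j T = C := by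
  obtain ⟨R, hR, h⟩ := exists_sqrt_eq_comp_adjoint hj hC hCj
  refine ⟨adjoint R ∘L R, ?_, ?_, compress_adjoint_comp_self hC h⟩
  · rw [nonneg_iff_isPositive]
    exact isPositive_adjoint_comp_self R
  · refine (opNorm_comp_le _ _).trans ?_
    rw [LinearIsometryEquiv.norm_map]
    exact mul_le_one₀ hR (norm_nonneg _) hR

theorem compress_mem_Icc (j : K →L[ℂ] H) {T : K →L[ℂ] K} (hT : 0 ≤ T) (hT1 : ‖T‖ ≤ 1) :
    compress j T ∈ Set.Icc 0 (compress j 1) :=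
  ⟨compress_nonneg j hT, compress_mono j ((CStarAlgebra.norm_le_one_iff_of_nonneg T hT).1 hT1)⟩

/-- Compression is an affine bijection of the positive part of the unit ball onto the interval
`[0, j j†]`, so it matches the extreme points of the two sets; those of the former are the
orthogonal projections. -/
theorem compress_mem_extremePoints_iff {j : K →L[ℂ] H} (hj : DenseRange (adjoint j))
    {T : K →L[ℂ] K} (hT : 0 ≤ T) (hT1 : ‖T‖ ≤ 1) :
    compress j T ∈ Set.extremePoints ℝ (Set.Icc 0 (compress j 1)) ↔ IsStarProjection T := by
  rw [isStarProjection_iff_mem_extremePoints_setOfPred_nonneg_inter_unitClosedBall,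
    mem_extremePoints_iff_left, mem_extremePoints_iff_left]
  constructor
  · rintro ⟨-, h⟩
    refine ⟨⟨hT, by simpa using hT1⟩, fun S₁ hS₁ S₂ hS₂ hS => compress_injective hj ?_⟩
    refine h _ (compress_mem_Icc j hS₁.1 (by simpa using hS₁.2)) _
      (compress_mem_Icc j hS₂.1 (by simpa using hS₂.2)) ?_
    obtain ⟨a, b, ha, hb, hab, rfl⟩ := hS
    exact ⟨a, b, ha, hb, hab, by simp only [map_add, map_smul]⟩
  · rintro ⟨-, h⟩
    refine ⟨compress_mem_Icc j hT hT1, fun C₁ hC₁ C₂ hC₂ hC => ?_⟩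
    obtain ⟨S₁, h₁, h₁', rfl⟩ := exists_compress_eq hj hC₁.1 hC₁.2
    obtain ⟨S₂, h₂, h₂', rfl⟩ := exists_compress_eq hj hC₂.1 hC₂.2
    obtain ⟨a, b, ha, hb, hab, hT'⟩ := hC
    congr 1
    refine h S₁ ⟨h₁, by simpa using h₁'⟩ S₂ ⟨h₂, by simpa using h₂'⟩
      ⟨a, b, ha, hb, hab, compress_injective hj ?_⟩
    simpa only [map_add, map_smul] using hT'

/-- Write `T = R† R` and `1 - T = S† S`, where `j R†` and `j S†` are the square roots of `j T j†`
and `j (1 - T) j†`. Then `j T (1 - T) = j R† (R S† S) = j S† (S R† R)` maps into both ranges, so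
singularity forces `T (1 - T) = 0`. Conversely, if `T` is a projection, then `R S† = 0`, so the
ranges of `R†` and `S†` are orthogonal, and `j` is injective. -/
theorem singular_compress_iff {j : K →L[ℂ] H} (hj : DenseRange (adjoint j))
    {T : K →L[ℂ] K} (hT : 0 ≤ T) (hT1 : ‖T‖ ≤ 1) :
    Singular (compress j T) (compress j 1 - compress j T) ↔ IsStarProjection T := by
  have hinj := injective_of_denseRange_adjoint hj
  have hmem := compress_mem_Icc j hT hT1
  have hpos : 0 ≤ compress j 1 - compress j T := sub_nonneg.2 hmem.2
  obtain ⟨R, -, hR⟩ := exists_sqrt_eq_comp_adjoint hj hmem.1 hmem.2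
  obtain ⟨S, -, hS⟩ := exists_sqrt_eq_comp_adjoint hj hpos (sub_le_self _ hmem.1)
  have hRT : adjoint R ∘L R = T :=
    compress_injective hj (compress_adjoint_comp_self hmem.1 hR)
  have hST : adjoint S ∘L S = 1 - T :=
    compress_injective hj (by rw [compress_adjoint_comp_self hpos hS, map_sub])
  have hRT' (k : K) : adjoint R (R k) = T k := congrArg (· k) hRT
  have hST' (k : K) : adjoint S (S k) = k - T k := congrArg (· k) hST
  rw [Singular, sqrt_eq_comp_adjoint_right hR, sqrt_eq_comp_adjoint_right hS]
  constructor
  · intro h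
    refine ⟨ContinuousLinearMap.ext fun k => ?_, IsSelfAdjoint.of_nonneg hT⟩
    have hk : j (T (k - T k)) ∈ ({0} : Set H) := by
      rw [← h]
      refine ⟨⟨R (k - T k), ?_⟩, ⟨S (T k), ?_⟩⟩
      · simp only [comp_apply, hRT']
      · simp only [comp_apply, hST', map_sub]
    have h0 : T (k - T k) = 0 := hinj (by rw [map_zero]; exact hk)
    rw [map_sub, sub_eq_zero] at h0
    exact h0.symm
  · intro hP
    have hTT (k : K) : T (T k) = T k := congrArg (· k) hP.isIdempotentElem.eq
    -- `S T = 0`, because `‖S T k‖² = ⟨(1 - T) T k, T k⟩`.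
    have hSTk (k : K) : S (T k) = 0 := by
      rw [← inner_self_eq_zero (𝕜 := ℂ), ← adjoint_inner_left, hST', hTT, sub_self,
        inner_zero_left]
    -- `R S† = 0`, because `‖R S† v‖² = ⟨S T S† v, v⟩`.
    have hRS (v : H) : R (adjoint S v) = 0 := by
      rw [← inner_self_eq_zero (𝕜 := ℂ), ← adjoint_inner_left, hRT', adjoint_inner_right, hSTk,
        inner_zero_left]
    refine Set.eq_singleton_iff_unique_mem.2 ⟨⟨⟨0, by simp⟩, ⟨0, by simp⟩⟩, ?_⟩
    rintro _ ⟨⟨u, rfl⟩, ⟨v, hv⟩⟩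
    have huv : adjoint S v = adjoint R u := hinj hv
    have h0 : adjoint R u = 0 := by
      rw [← inner_self_eq_zero (𝕜 := ℂ), adjoint_inner_left, ← huv, hRS, inner_zero_right]
    simp [h0]

end Compression

/-! ### Parallel sums of compressions -/

section Short

variable {H K : Type*} [NormedAddCommGroup H] [InnerProductSpace ℂ H] [CompleteSpace H]
  [NormedAddCommGroup K] [InnerProductSpace ℂ K] [CompleteSpace K]

/-- In terms of `k = j† x` and `w = j† y`, the form defining `j j† : (n j T j†)` is
`‖k - w‖² + n ⟨T w, w⟩`. -/
theorem parallelSum_compress_re {j : K →L[ℂ] H} {T : K →L[ℂ] K} {A B : H →L[ℂ] H}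
    (hA : 0 ≤ A) (hB : 0 ≤ B) (hAj : A = compress j T) (hBj : B = compress j 1) (n : ℕ) (x : H) :
    (⟪parallelSum B (n • A) hB (nsmul_nonneg hA n) x, x⟫_ℂ).re =
      ⨅ y : H, (‖adjoint j x - adjoint j y‖ ^ 2
        + n * (⟪T (adjoint j y), adjoint j y⟫_ℂ).re) := by
  rw [parallelSum_re]
  refine iInf_congr fun y => ?_
  have h1 : ⟪B (x - y), x - y⟫_ℂ = ((‖adjoint j x - adjoint j y‖ ^ 2 : ℝ) : ℂ) := by
    rw [hBj, inner_compress, map_sub]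
    exact (inner_self_eq_norm_sq_to_K _).trans (by simp)
  have h2 : ⟪(n • A) y, y⟫_ℂ = n * ⟪T (adjoint j y), adjoint j y⟫_ℂ := by
    rw [hAj, ← Nat.cast_smul_eq_nsmul ℂ, smul_apply, inner_smul_left, inner_compress]
    simp
  rw [h1, h2, Complex.ofReal_re, ← Complex.ofReal_natCast, Complex.re_ofReal_mul]

/-- The hypothesis is what `j j† : (n j T j†) ≤ j T j†` for all `n` says about `k ∈ ran j†`. It
forces `⟨T w, w⟩ → 0`, so `T w → 0`, while `‖k - w‖² ≤ ⟨T k, k⟩` up to a vanishing error. In the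
limit `⟨T k, k⟩ = ⟨T k, k - w⟩ + ⟨k, T w⟩` gives `⟨T k, k⟩ ≤ ‖T k‖ ⟨T k, k⟩^{1/2}`. -/
theorem inner_le_norm_sq_of_forall_exists {T : K →L[ℂ] K} (hT : 0 ≤ T) (hT1 : ‖T‖ ≤ 1) {k : K}
    (h : ∀ n : ℕ, ∃ w : K, ‖k - w‖ ^ 2 + n * (⟪T w, w⟫_ℂ).re
      ≤ (⟪T k, k⟫_ℂ).re + 1 / ((n : ℝ) + 1)) :
    (⟪T k, k⟫_ℂ).re ≤ ‖T k‖ ^ 2 := by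
  choose w hw using h
  set q := (⟪T k, k⟫_ℂ).re with hq
  have hq0 : 0 ≤ q := inner_nonneg hT k
  have hlim : Filter.Tendsto (fun n : ℕ => 1 / ((n : ℝ) + 1)) Filter.atTop (nhds 0) :=
    tendsto_one_div_add_atTop_nhds_zero_nat
  have hTw (n : ℕ) : ‖T (w n)‖ ^ 2 ≤ (⟪T (w n), w n⟫_ℂ).re :=
    (norm_apply_sq_le hT _).trans (mul_le_of_le_one_left (inner_nonneg hT _) hT1)
  have hbd (n : ℕ) : ‖T (w (n + 1))‖ ^ 2 ≤ (q + 1) * (1 / ((n : ℝ) + 1)) := by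
    have h1 := hw (n + 1)
    have h2 := hTw (n + 1)
    have h3 : (1 : ℝ) / (((n + 1 : ℕ) : ℝ) + 1) ≤ 1 := by
      rw [div_le_one (by positivity)]
      linarith [(Nat.cast_nonneg (n + 1) : (0 : ℝ) ≤ _)]
    rw [mul_one_div, le_div_iff₀ (by positivity)]
    push_cast at h1 h3
    nlinarith [sq_nonneg ‖k - w (n + 1)‖, (Nat.cast_nonneg n : (0 : ℝ) ≤ n)]
  have hTw0 : Filter.Tendsto (fun n => ‖T (w (n + 1))‖) Filter.atTop (nhds 0) := by
    have h1 : Filter.Tendsto (fun n => ‖T (w (n + 1))‖ ^ 2) Filter.atTop (nhds 0) :=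
      squeeze_zero (fun n => sq_nonneg _) hbd (by simpa using hlim.const_mul (q + 1))
    simpa [Real.sqrt_sq] using h1.sqrt
  have hkey (n : ℕ) : q ≤ ‖T k‖ * √(q + 1 / (((n + 1 : ℕ) : ℝ) + 1))
      + ‖k‖ * ‖T (w (n + 1))‖ := by
    have h1 : ‖k - w (n + 1)‖ ≤ √(q + 1 / (((n + 1 : ℕ) : ℝ) + 1)) := by
      refine Real.le_sqrt_of_sq_le ?_
      have := mul_nonneg (Nat.cast_nonneg (n + 1) : (0 : ℝ) ≤ _) (inner_nonneg hT (w (n + 1)))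
      linarith [hw (n + 1)]
    have h2 : q = (⟪T k, k - w (n + 1)⟫_ℂ).re + (⟪k, T (w (n + 1))⟫_ℂ).re := by
      rw [← inner_symm hT, inner_sub_right, Complex.sub_re]
      ring
    have h3 := re_inner_le_norm (𝕜 := ℂ) (T k) (k - w (n + 1))
    have h4 := re_inner_le_norm (𝕜 := ℂ) k (T (w (n + 1)))
    rw [RCLike.re_eq_complex_re] at h3 h4
    have h5 := mul_le_mul_of_nonneg_left h1 (norm_nonneg (T k))
    linarith
  have hle : q ≤ ‖T k‖ * √q := by
    have h1 := hlim.comp (Filter.tendsto_add_atTop_nat 1)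
    have h2 := (((h1.const_add q).sqrt).const_mul ‖T k‖).add (hTw0.const_mul ‖k‖)
    rw [add_zero, mul_zero, add_zero] at h2
    exact ge_of_tendsto' h2 hkey
  have h1 := Real.mul_self_sqrt hq0
  have h2 := Real.sqrt_nonneg q
  rcases h2.eq_or_lt with h0 | h0
  · rw [← h1, ← h0]
    simp
  · have h3 : √q ≤ ‖T k‖ := by
      rw [← h1] at hle
      exact le_of_mul_le_mul_right (by simpa [Real.sqrt_mul_self h2] using hle) h0
    rw [← h1, ← sq]
    gcongr

theorem isStarProjection_of_inner_le {j : K →L[ℂ] H} (hj : DenseRange (adjoint j))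
    {T : K →L[ℂ] K} (hT : 0 ≤ T) (hT1 : ‖T‖ ≤ 1)
    (h : ∀ x : H, (⟪T (adjoint j x), adjoint j x⟫_ℂ).re ≤ ‖T (adjoint j x)‖ ^ 2) :
    IsStarProjection T := by
  have hle (k : K) : (⟪T k, k⟫_ℂ).re ≤ ‖T k‖ ^ 2 :=
    hj.induction_on k (isClosed_le (by fun_prop) (by fun_prop)) h
  refine ⟨coe_injective ((ext_inner_map _ _).1 fun k => ?_), IsSelfAdjoint.of_nonneg hT⟩
  have h1 : ‖T k‖ ^ 2 = (⟪T k, k⟫_ℂ).re := le_antisymm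
    ((norm_apply_sq_le hT k).trans (mul_le_of_le_one_left (inner_nonneg hT k) hT1)) (hle k)
  change ⟪T (T k), k⟫_ℂ = ⟪T k, k⟫_ℂ
  rw [inner_symm hT, inner_self_eq_norm_sq_to_K]
  refine Complex.ext ?_ (by simp [inner_im hT, ← Complex.ofReal_pow])
  rw [← h1]
  simp [← Complex.ofReal_pow]

/-- In an inner product space the bound is attained at `b = a / (n + 1)`. -/
theorem mul_norm_sq_le {E : Type*} [SeminormedAddCommGroup E] (a b : E) (n : ℕ) :
    (n : ℝ) / (n + 1) * ‖a‖ ^ 2 ≤ ‖a - b‖ ^ 2 + n * ‖b‖ ^ 2 := by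
  have h := norm_le_norm_sub_add a b
  have hn : (0 : ℝ) ≤ n := Nat.cast_nonneg n
  rw [div_mul_eq_mul_div, div_le_iff₀ (by positivity)]
  have h1 : ‖a‖ ^ 2 ≤ (‖a - b‖ + ‖b‖) ^ 2 := by gcongr
  nlinarith [sq_nonneg (‖a - b‖ - n * ‖b‖), mul_le_mul_of_nonneg_left h1 hn]

/-- `[j T j†](j j†)` equals `j T j†` exactly when `T` is a projection. For a projection `P`,
`n / (n + 1) j P j† ≤ j j† : (n j P j†) ≤ j P j†`. -/
theorem eq_generalizedShort_compress_iff {j : K →L[ℂ] H} (hj : DenseRange (adjoint j))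
    {T : K →L[ℂ] K} (hT : 0 ≤ T) (hT1 : ‖T‖ ≤ 1) {A B : H →L[ℂ] H} (hA : 0 ≤ A) (hB : 0 ≤ B)
    (hAj : A = compress j T) (hBj : B = compress j 1) :
    A = generalizedShort A B hA hB ↔ IsStarProjection T := by
  have hlub := generalizedShort_isLUB hA hB
  have hAx (x : H) : (⟪A x, x⟫_ℂ).re = (⟪T (adjoint j x), adjoint j x⟫_ℂ).re := by
    rw [hAj, inner_compress]
  constructor
  · intro h
    rw [← h] at hlub
    refine isStarProjection_of_inner_le hj hT hT1 fun x =>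
      inner_le_norm_sq_of_forall_exists hT hT1 fun n => ?_
    have h1 := inner_mono (hlub.1 ⟨n, rfl⟩) x
    dsimp only at h1
    rw [parallelSum_compress_re hA hB hAj hBj, hAx] at h1
    obtain ⟨y, hy⟩ := exists_lt_of_ciInf_lt
      (h1.trans_lt (lt_add_of_pos_right _ (Nat.one_div_pos_of_nat (α := ℝ) (n := n))))
    exact ⟨_, hy.le⟩
  · intro hP
    have hPP (k : K) : (⟪T k, k⟫_ℂ).re = ‖T k‖ ^ 2 := by
      have h1 : T (T k) = T k := congrArg (· k) hP.isIdempotentElem.eq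
      conv_lhs => rw [← h1, inner_symm hT]
      exact (norm_sq_eq_re_inner (𝕜 := ℂ) _).symm
    refine IsLUB.unique ⟨?_, fun D hD => ?_⟩ hlub
    · rintro _ ⟨n, rfl⟩
      refine le_of_inner_le (parallelSum_nonneg _ _) hA fun x => ?_
      dsimp only
      rw [parallelSum_compress_re hA hB hAj hBj, hAx]
      -- The bound is the value of the form at `w = k - T k`, which is a limit of vectors `j† y`.
      have hle (w : K) : (⨅ y : H, (‖adjoint j x - adjoint j y‖ ^ 2
          + n * (⟪T (adjoint j y), adjoint j y⟫_ℂ).re))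
          ≤ ‖adjoint j x - w‖ ^ 2 + n * (⟪T w, w⟫_ℂ).re := by
        refine hj.induction_on w (isClosed_le (by fun_prop) (by fun_prop)) fun y => ?_
        refine ciInf_le (f := fun y : H => ‖adjoint j x - adjoint j y‖ ^ 2
          + n * (⟪T (adjoint j y), adjoint j y⟫_ℂ).re) ⟨0, ?_⟩ y
        rintro _ ⟨z, rfl⟩
        have := inner_nonneg hT (adjoint j z)
        positivity
      refine (hle (adjoint j x - T (adjoint j x))).trans (le_of_eq ?_)
      have h1 : T (T (adjoint j x)) = T (adjoint j x) :=
        congrArg (· (adjoint j x)) hP.isIdempotentElem.eq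
      simp [hPP, h1]
    · have hD0 : 0 ≤ D := (parallelSum_nonneg _ _).trans (hD ⟨0, rfl⟩)
      refine le_of_inner_le hA hD0 fun x => ?_
      have hn (n : ℕ) : (n : ℝ) / (n + 1) * (⟪A x, x⟫_ℂ).re ≤ (⟪D x, x⟫_ℂ).re := by
        refine le_trans ?_ (inner_mono (hD ⟨n, rfl⟩) x)
        dsimp only
        rw [parallelSum_compress_re hA hB hAj hBj, hAx, hPP]
        refine le_ciInf fun y => ?_
        rw [hPP]
        refine (mul_norm_sq_le _ (T (adjoint j y)) n).trans ?_
        gcongr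
        rw [← map_sub]
        exact T.le_of_opNorm_le hT1 _ |>.trans_eq (one_mul _)
      have hlim := (tendsto_natCast_div_add_atTop (1 : ℝ)).mul_const (⟪A x, x⟫_ℂ).re
      rw [one_mul] at hlim
      exact le_of_tendsto' hlim hn

end Short

/-! ### The canonical embedding of the auxiliary space -/

variable {H : Type*} [NormedAddCommGroup H] [InnerProductSpace ℂ H] [CompleteSpace H]

theorem denseRange_adjoint_J (B : H →L[ℂ] H) (hB : 0 ≤ B) : DenseRange (adjoint (J B hB)) := by
  have : ⇑(adjoint (J B hB)) = toAux B hB := funext (adjoint_J B hB)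
  rw [this]
  exact denseRange_toAux B hB

theorem eq_compress_J_one (B : H →L[ℂ] H) (hB : 0 ≤ B) : B = compress (J B hB) 1 := by
  ext x
  rw [compress_apply, adjoint_J]
  exact (J_coe_mk B hB x).symm

end QuasiUnit

theorem mainTheorem1 {H : Type*} [NormedAddCommGroup H] [InnerProductSpace ℂ H] [CompleteSpace H]
    (A B : H →L[ℂ] H) (hA : 0 ≤ A) (hB : 0 ≤ B) (hAB : A ≤ B) :
    List.TFAE [
      A = QuasiUnit.generalizedShort A B hA hB,
      ∃ P : QuasiUnit.AuxSpace B hB →L[ℂ] QuasiUnit.AuxSpace B hB,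
        IsStarProjection P ∧
          A = QuasiUnit.J B hB ∘L P ∘L ContinuousLinearMap.adjoint (QuasiUnit.J B hB),
      A ∈ Set.extremePoints ℝ (Set.Icc (0 : H →L[ℂ] H) B),
      QuasiUnit.Singular A (B - A)] := by
  have hJ := QuasiUnit.denseRange_adjoint_J B hB
  have hBJ := QuasiUnit.eq_compress_J_one B hB
  obtain ⟨T, hT, hT1, hAT⟩ := QuasiUnit.exists_compress_eq hJ hA (hBJ ▸ hAB)
  have h1 : A = QuasiUnit.generalizedShort A B hA hB ↔ IsStarProjection T :=
    QuasiUnit.eq_generalizedShort_compress_iff hJ hT hT1 hA hB hAT.symm hBJ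
  have h2 : (∃ P : QuasiUnit.AuxSpace B hB →L[ℂ] QuasiUnit.AuxSpace B hB, IsStarProjection P ∧
      A = QuasiUnit.J B hB ∘L P ∘L ContinuousLinearMap.adjoint (QuasiUnit.J B hB)) ↔
      IsStarProjection T := by
    refine ⟨fun ⟨P, hP, hAP⟩ => ?_, fun h => ⟨T, h, hAT.symm⟩⟩
    rwa [QuasiUnit.compress_injective hJ (hAT.trans hAP)]
  have h3 : A ∈ Set.extremePoints ℝ (Set.Icc (0 : H →L[ℂ] H) B) ↔ IsStarProjection T := by
    have := QuasiUnit.compress_mem_extremePoints_iff hJ hT hT1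
    rwa [← hBJ, hAT] at this
  have h4 : QuasiUnit.Singular A (B - A) ↔ IsStarProjection T := by
    have := QuasiUnit.singular_compress_iff hJ hT hT1
    rwa [← hBJ, hAT] at this
  rw [h1, h2, h3, h4]
  tfae_finish
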